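/- Let $\mathbb F_q$ be a finite field of characteristic $p$, let $f\in\mathbb F_q[x]$ be nonzero, and let $n=p^t u\ge 1$ with $t\ge 0$ and $p\nmid u$. For $f=\sum_i a_ix^i$ put $L_f(x)=\sum_i a_ix^{q^i}$. Let $h=\gcd(f,x^u-1)$ (monic) and $S_f=(x^u-1)/h$. The functional graph $\mathcal G(L_f/\mathbb F_{q^n})$ of the map $c\mapsto L_f(c)$ has vertex set $\mathbb F_{q^n}$ and directed edges $c\to L_f(c)$. Notation. For nonzero $g\in\mathbb F_q[x]$, let $N(g)=\#\,\mathbb F_q[x]/(g)=q^{\deg g}$ and let $\Phi_q(g)$ be the number of units of $\mathbb F_q[x]/(g)$ (so $\Phi_q(1)=1$). For $\gcd(f,g)=1$, let $\mathcal O(f,g)$ be the least positive integer $k$ with $f^k\equiv 1\pmod g$. Write $\oplus$ for disjoint union of graphs and $k\times G$ for the disjoint union of $k$ copies of $G$. Edges of rooted trees point towards the root; $\bullet$ is the one-vertex tree, and for rooted trees $T_1,\dots,T_k$, $\langle T_1\oplus\dots\oplus T_k\rangle$ is the rooted tree whose root has exactly $k$ predecessors, which are roots of copies of $T_1,\dots,T_k$.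 $\mathrm{Cyc}(m,T)$ is the graph formed by a directed cycle of length $m$, each node of which is the root of a copy of $T$. For a non-increasing sequence $V=(\nu_1,\dots,\nu_d)$ of positive integers, $d\ge1$, put $T_V^0=\bullet$, $$T_V^k=\Big\langle \nu_k\times T_V^{k-1}\oplus\bigoplus_{i=1}^{k-1}(\nu_i-\nu_{i+1})\times T_V^{i-1}\Big\rangle\quad(1\le k<d),$$ $$T_V=\Big\langle(\nu_d-1)\times T_V^{d-1}\oplus\bigoplus_{i=1}^{d-1}(\nu_i-\nu_{i+1})\times T_V^{i-1}\Big\rangle.$$ For $b\in\mathbb F_q[x]$ nonzero dividing a power of $f$, the $\nu$-series of $b$ and $f$ is $b(f)=(N(a_1),\dots,N(a_d))$, where $a_1=\gcd(b,f)$, $a_{i+1}=\gcd\big(b/(a_1\cdots a_i),f\big)$ and $d$ is the least positive integer such that $a_1\cdots a_d$ equals $b$ up to a unit. $T_{h^{p^t}(f)}$ is the tree $T_V$ for the $\nu$-series $V=h^{p^t}(f)$ of $b=h^{p^t}$ and $f$. Theorem. For every monic divisor $g$ of $S_f^{p^t}$ in $\mathbb F_q[x]$ one has $\gcd(f,g)=1$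 and $\mathcal O(f,g)\mid\Phi_q(g)$, and there is an isomorphism of directed graphs $$\mathcal G(L_f/\mathbb F_{q^n})\;\cong\;\bigoplus_{g\mid S_f^{p^t}}\frac{\Phi_q(g)}{\mathcal O(f,g)}\times\mathrm{Cyc}\big(\mathcal O(f,g),\,T_{h^{p^t}(f)}\big),$$ where $g$ runs over the monic divisors of $S_f^{p^t}$ in $\mathbb F_q[x]$. -/

import Mathlib

open Polynomial

noncomputable section

namespace LinDyn

/-! ### Directed graphs -/

/-- The functional graph of `φ : X → X`: vertices the elements of `X`, edges `x ⟶ φ x`. -/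
def functionalGraph {X : Type*} (φ : X → X) : Digraph X where
  Adj x y := φ x = y

/-- Isomorphism of directed graphs. -/
def GraphIso {V W : Type*} (G : Digraph V) (H : Digraph W) : Prop :=
  Nonempty (G.Adj ≃r H.Adj)

/-- The edges of a disjoint union of graphs. -/
inductive UnionAdj {ι : Type*} {V : ι → Type*} (G : ∀ i, Digraph (V i)) :
    (Σ i, V i) → (Σ i, V i) → Prop
  | mk (i : ι) (x y : V i) (h : (G i).Adj x y) : UnionAdj G ⟨i, x⟩ ⟨i, y⟩

/-- The disjoint union `⨁ i, G i` of a family of graphs. -/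
def disjointUnion {ι : Type*} {V : ι → Type*} (G : ∀ i, Digraph (V i)) :
    Digraph (Σ i, V i) where
  Adj := UnionAdj G

/-- `k × G`: the disjoint union of `k` copies of `G`. -/
def copies {V : Type*} (k : ℕ) (G : Digraph V) : Digraph (Σ _ : Fin k, V) :=
  disjointUnion fun _ => G

/-! ### Rooted trees -/

/-- Finite rooted trees: a root together with the finitely many trees hanging on it. -/
inductive RTree : Type
  | node (k : ℕ) (child : Fin k → RTree) : RTree

namespace RTree

/-- The vertices of a tree: `none` is the root, and `some ⟨i, v⟩` is the vertex `v` of the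
`i`-th tree hanging on the root. -/
def Vertex : RTree → Type
  | node k child => Option (Σ i : Fin k, (child i).Vertex)

/-- The root. -/
def root : (T : RTree) → T.Vertex
  | node _ _ => none

/-- The vertex that follows a given one on the way to the root; `none` at the root itself. -/
def parent : (T : RTree) → T.Vertex → Option T.Vertex
  | node _ _, none => none
  | node _ child, some ⟨i, v⟩ => some (((child i).parent v).map fun w => ⟨i, w⟩)

/-- The rooted tree as a directed graph, with all edges directed towards the root. -/
def graph (T : RTree) : Digraph T.Vertex where
  Adj v w := T.parent v = some w

/-- The tree `⟨G⟩`: a root whose predecessors are the roots of the trees of the forest `G`. -/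
def join (G : List RTree) : RTree :=
  node G.length G.get

/-- The tree with a unique node. -/
def bullet : RTree :=
  join []

end RTree

/-- `Cyc(m, T)`: a directed cycle of length `m ≥ 1` each node of which is the root of a copy
of `T`. The vertex `(i, v)` is the vertex `v` of the `i`-th copy. -/
def cyc (m : ℕ) (T : RTree) : Digraph (ZMod m × T.Vertex) where
  Adj x y := (x.1 = y.1 ∧ T.graph.Adj x.2 y.2) ∨
    (x.2 = T.root ∧ y.2 = T.root ∧ y.1 = x.1 + 1)

/-- The trees `T_V^k` for `V = (ν 1, ν 2, …)`: `T_V^0 = •`, and for `k ≥ 1`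
`T_V^k = ⟨ν_k × T_V^{k-1} ⊕ ⨁_{1 ≤ i ≤ k-1} (ν_i - ν_{i+1}) × T_V^{i-1}⟩`. -/
def partialTree (ν : ℕ → ℕ) : ℕ → RTree
  | 0 => RTree.bullet
  | k + 1 => RTree.join (List.replicate (ν (k + 1)) (partialTree ν k) ++
      (List.finRange k).flatMap fun i =>
        List.replicate (ν (i.val + 1) - ν (i.val + 2)) (partialTree ν i.val))
termination_by k => k
decreasing_by all_goals omega

/-- The elementary tree `T_V` of `V = (ν 1, …, ν d)`, a non-increasing sequence of `d ≥ 1`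
positive integers:
`T_V = ⟨(ν_d - 1) × T_V^{d-1} ⊕ ⨁_{1 ≤ i ≤ d-1} (ν_i - ν_{i+1}) × T_V^{i-1}⟩`. -/
def elementaryTree (d : ℕ) (ν : ℕ → ℕ) : RTree :=
  RTree.join (List.replicate (ν d - 1) (partialTree ν (d - 1)) ++
    (List.finRange (d - 1)).flatMap fun i =>
      List.replicate (ν (i.val + 1) - ν (i.val + 2)) (partialTree ν i.val))

/-! ### Arithmetic of polynomials over a finite field -/

variable {F : Type*} [Field F]

open Classical in
/-- The monic greatest common divisor (`0` if both polynomials vanish). -/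
def monicGcd (a b : F[X]) : F[X] :=
  normalize (EuclideanDomain.gcd a b)

/-- The norm of `g`: the cardinality of `F[x] / (g)`. -/
def polyNorm (g : F[X]) : ℕ :=
  Nat.card (F[X] ⧸ Ideal.span {g})

/-- Euler's function `Φ_q(g)`: the number of units of `F[x] / (g)`. -/
def polyPhi (g : F[X]) : ℕ :=
  Nat.card (F[X] ⧸ Ideal.span {g})ˣ

/-- `𝒪(f, g)`: the least positive `k` with `f ^ k ≡ 1 (mod g)`. -/
def polyOrd (f g : F[X]) : ℕ :=
  orderOf (Ideal.Quotient.mk (Ideal.span {g}) f)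

/-- `b / (a_1 ⋯ a_i)` in the construction of the `ν`-series of `b` and `a`. -/
def nuRest (b a : F[X]) : ℕ → F[X]
  | 0 => b
  | i + 1 => nuRest b a i / monicGcd (nuRest b a i) a

/-- The factors of the `ν`-series of `b` and `a`, for `i ≥ 1`:
`a_i = gcd (b / (a_1 ⋯ a_{i-1}), a)`. -/
def nuFactor (b a : F[X]) (i : ℕ) : F[X] :=
  monicGcd (nuRest b a (i - 1)) a

/-- The length of the `ν`-series: the least positive `d` such that `a_1 ⋯ a_d` and `b` generate
the same ideal. -/
def nuLength (b a : F[X]) : ℕ :=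
  sInf {d : ℕ | 0 < d ∧
    Ideal.span {∏ j ∈ Finset.Icc 1 d, nuFactor b a j} = Ideal.span {b}}

/-- The tree `T_{b(a)}` of the `ν`-series `b(a) = (N(a_1), …, N(a_d))`. -/
def nuTree (b a : F[X]) : RTree :=
  elementaryTree (nuLength b a) fun i => polyNorm (nuFactor b a i)

/-- The `q`-associate `L_f = ∑ a_i x^(q^i)` of `f = ∑ a_i x^i`, where `q = #F`. -/
def qAssociate (f : F[X]) : F[X] :=
  f.sum fun i a => monomial (Nat.card F ^ i) a

/-- `S_f = (x^u - 1) / gcd(f, x^u - 1)`. -/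
def coprimePart (f : F[X]) (u : ℕ) : F[X] :=
  (X ^ u - 1) / monicGcd f (X ^ u - 1)

end LinDyn

end

/-!
Let `σ` be the `q`-Frobenius of `K` over `F`. Then `L_f` acts on `K` as `f(σ)`, and the normal
basis theorem, in the form `K ≅ F[X] / (X ^ n - 1)` as modules over `F[X]` with `X` acting as `σ`,
turns `L_f` into multiplication by `f` on `F[X] / (X ^ n - 1)` (`exists_equiv_quotient`,
`aeval_qAssociate`). In characteristic `p` one has
`X ^ n - 1 = (X ^ u - 1) ^ (p ^ t) = h ^ (p ^ t) * S_f ^ (p ^ t)`; since `X ^ u - 1` is separable,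
`S_f` is prime to `f`, while `h ^ (p ^ t)` divides a power of `f`. By the Chinese remainder theorem
the map is the product of a nilpotent multiplication on `F[X] / (b)`, `b = h ^ (p ^ t)`, and a
permutation of `F[X] / (s)`, `s = S_f ^ (p ^ t)`.

*Product of a tree and cycles* (`graphIso_prodMap`). If `α` is a map on `A` all of whose orbits end
in a fixed point `z`, with tree `T` hanging at `z`, and `β` is a permutation of `B`, the shear
`(a, b) ↦ (a, β ^ (-depth a) b)` makes the second coordinate constant along the edges of `T`, so the
graph of `α × β` is obtained by hanging a copy of `T` on each node of each cycle of `β`.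

*Cycles* (`exists_equiv_units_cycles`). The elements of `F[X] / (s)` with annihilator `(g)` are the
multiples of `s / g` by the units of `F[X] / (g)`. On them `f` acts as a unit of `F[X] / (g)` of
order `𝒪(f, g)`, whose cosets are the cycles.

*Tree* (`hangsAt_nuTree`). For a nilpotent endomorphism `φ` of a finite abelian group `M` put
`ν_i = #(ker φ ∩ φ ^ (i - 1) M)`. Say that `v ≠ 0` has height `k` if it lies in `φ ^ k M` but not in
`φ ^ (k + 1) M`. The predecessors of such a `v` lying in `φ ^ (i - 1) M`, for `i ≤ k`, form a coset
of `ker φ ∩ φ ^ (i - 1) M`, so `ν_i - ν_(i + 1)` of them have height `i - 1 < k - 1` and `ν_k` have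
height `k - 1`. Hence `T_V^k` hangs at `v`, and `T_V` hangs at `0`, where the loop removes one
predecessor (`hangsAt_partialTree`, `hangsAt_elementaryTree`). For multiplication by `f` on
`F[X] / (b)`, the group `ker φ ∩ φ ^ (i - 1) M` is the annihilator of `a_i`, which has `N(a_i)`
elements (`ncard_ker_inter_range_iterate`).
-/

noncomputable section

namespace LinDyn

open Function Relation

/-! ### Forests given by a parent map -/

/-- As functional graphs have exactly one edge leaving each vertex, a bijection that preserves
edges from a graph without sinks also reflects them. -/
theorem graphIso_of_hom {V W : Type*} {G : Digraph W} {φ : V → V} (e : W ≃ V)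
    (hout : ∀ x, ∃ y, G.Adj x y) (he : ∀ x y, G.Adj x y → φ (e x) = e y) :
    GraphIso (functionalGraph φ) G := by
  refine ⟨RelIso.symm ⟨e, ?_⟩⟩
  intro x y
  refine ⟨fun h => ?_, he x y⟩
  obtain ⟨y', hy'⟩ := hout x
  have h' : φ (e x) = e y := h
  have : y' = y := e.injective ((he x y' hy').symm.trans h')
  exact this ▸ hy'

theorem graphIso_functionalGraph_of_semiconj {X Y : Type*} {V : Type*} {G : Digraph V}
    {φ : X → X} {ψ : Y → Y} (e : X ≃ Y) (he : Semiconj e φ ψ)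
    (h : GraphIso (functionalGraph ψ) G) : GraphIso (functionalGraph φ) G := by
  obtain ⟨i⟩ := h
  refine ⟨RelIso.trans ⟨e, ?_⟩ i⟩
  intro a b
  change ψ (e a) = e b ↔ φ a = b
  rw [← he a, e.apply_eq_iff_eq]

/-- The tree `T` hangs at `v` in the forest given by the partial map `par`, which sends a node to
the node it points to: recursively, the nodes pointing to `v` are enumerated without repetition by
the children of the root of `T`, and each child hangs at its node. -/
def HangsAt {M : Type*} (par : M → Option M) : RTree → M → Prop
  | .node k child, v => ∃ e : Fin k → M, Injective e ∧
      (∀ w, par w = some v ↔ ∃ i, e i = w) ∧ ∀ i, HangsAt par (child i) (e i)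

theorem reflTransGen_rank_le {M : Type*} {par : M → Option M} {rank : M → ℕ}
    (hr : ∀ w v, par w = some v → rank v < rank w) {w v : M}
    (h : ReflTransGen (fun a b => par a = some b) w v) : rank v ≤ rank w := by
  induction h with
  | refl => exact le_rfl
  | tail _ h ih => exact (hr _ _ h).le.trans ih

theorem eq_of_reflTransGen_siblings {M : Type*} {par : M → Option M} {rank : M → ℕ}
    (hr : ∀ w v, par w = some v → rank v < rank w) {a b v w : M}
    (ha : par a = some v) (hb : par b = some v)
    (hwa : ReflTransGen (fun a b => par a = some b) w a)
    (hwb : ReflTransGen (fun a b => par a = some b) w b) : a = b := by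
  have hu : Relator.RightUnique fun a b => par a = some b := fun x y z h1 h2 =>
    Option.some_injective _ ((h1 : par x = _).symm.trans h2)
  have key : ∀ {a b : M}, par a = some v → par b = some v →
      ReflTransGen (fun a b => par a = some b) a b → a = b := by
    intro a b ha hb hab
    rcases hab.cases_head with h | ⟨c, hac, hcb⟩
    · exact h
    · obtain rfl : c = v := Option.some_injective _ (hac.symm.trans ha)
      exact absurd (hr _ _ hb) (reflTransGen_rank_le hr hcb).not_gt
  rcases hwa.total_of_right_unique hu hwb with h | h
  · exact key ha hb h
  · exact (key hb ha h).symm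

/-- A tree hanging at `v` is isomorphic to the subgraph of the nodes that lead to `v`. The function
`rank` excludes cycles. -/
theorem HangsAt.exists_embedding {M : Type*} {par : M → Option M} {rank : M → ℕ}
    (hr : ∀ w v, par w = some v → rank v < rank w) (T : RTree) :
    ∀ v, HangsAt par T v → ∃ τ : T.Vertex → M, Injective τ ∧ τ T.root = v ∧
      (∀ x y, T.parent x = some y → par (τ x) = some (τ y)) ∧
      (∀ x, T.parent x = none → x = T.root) ∧
      ∀ w, ReflTransGen (fun a b => par a = some b) w v ↔ w ∈ Set.range τ := by
  induction T with
  | node k child ih =>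
    rintro v ⟨e, he, hpar, hsub⟩
    choose τ hinj hroot hedge hnone hrange using fun i => ih i (e i) (hsub i)
    have hev : ∀ i, par (e i) = some v := fun i => (hpar _).2 ⟨i, rfl⟩
    have hreach : ∀ i x, ReflTransGen (fun a b => par a = some b) (τ i x) (e i) :=
      fun i x => (hrange i _).2 ⟨x, rfl⟩
    have hne : ∀ i x, τ i x ≠ v := fun i x h =>
      (hr _ _ (hev i)).not_ge (h ▸ reflTransGen_rank_le hr (hreach i x))
    let σ : Option (Σ i, (child i).Vertex) → M := fun o => o.elim v fun s => τ s.1 s.2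
    refine ⟨σ, ?_, rfl, ?_, ?_, ?_⟩
    · rintro (_ | ⟨i, x⟩) (_ | ⟨j, y⟩) h
      · rfl
      · exact absurd h.symm (hne j y)
      · exact absurd h (hne i x)
      · replace h : τ i x = τ j y := h
        obtain rfl : i = j := he <|
          eq_of_reflTransGen_siblings hr (hev i) (hev j) (hreach i x) (h ▸ hreach j y)
        rw [hinj i h]
    · rintro (_ | ⟨i, x⟩) y h
      · cases h
      · change some (((child i).parent x).map fun w => ⟨i, w⟩) = some y at h
        obtain rfl := Option.some_injective _ h
        change par (τ i x) = _
        rcases hp : (child i).parent x with _ | w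
        · rw [hnone i x hp, hroot]
          exact hev i
        · exact hedge i x w hp
    · rintro (_ | ⟨i, x⟩) h
      · rfl
      · cases h
    · intro w
      constructor
      · intro h
        rcases h.cases_tail with h | ⟨c, hwc, hcv⟩
        · exact ⟨none, h⟩
        · obtain ⟨i, rfl⟩ := (hpar c).1 hcv
          obtain ⟨x, hx⟩ := (hrange i w).1 hwc
          exact ⟨some ⟨i, x⟩, hx⟩
      · rintro ⟨_ | ⟨i, x⟩, rfl⟩
        · exact .refl
        · exact (hreach i x).tail (hev i)

open Classical in
/-- The forest obtained from the functional graph of `α` by removing the edge that leaves `z`. -/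
def parentTo {A : Type*} (α : A → A) (z : A) (w : A) : Option A :=
  if w = z then none else some (α w)

theorem parentTo_eq_some {A : Type*} {α : A → A} {z w v : A} :
    parentTo α z w = some v ↔ w ≠ z ∧ α w = v := by
  unfold parentTo
  split_ifs with h <;> simp [h]

/-! ### Products of a tree with a permutation -/

section Product

variable {A B : Type*} {α : A → A} {z : A}

open Classical in
/-- The number of steps from `a` to the point `z` where all orbits of `α` end. -/
def depth (hnil : ∀ a, ∃ k, α^[k] a = z) (a : A) : ℕ := Nat.find (hnil a)

theorem depth_root (hnil : ∀ a, ∃ k, α^[k] a = z) : depth hnil z = 0 := by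
  simp [depth]

theorem depth_of_ne (hnil : ∀ a, ∃ k, α^[k] a = z) {a : A} (ha : a ≠ z) :
    depth hnil a = depth hnil (α a) + 1 := by
  classical
  unfold depth
  exact Nat.find_comp_succ (hnil a) (hnil (α a)) ha

/-- The product of a map contracting to a fixed point `z`, with tree `T`, and a permutation with
cycle decomposition `ψ` is a sum of cycles with a copy of `T` hanging on each node. -/
theorem graphIso_prodMap (hz : α z = z) (hnil : ∀ a, ∃ k, α^[k] a = z) {T : RTree}
    (hT : HangsAt (parentTo α z) T z) (β : Equiv.Perm B) {I : Type*} (k m : I → ℕ)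
    (ψ : (Σ i, Σ _ : Fin (k i), ZMod (m i)) ≃ B)
    (hψ : ∀ i j c, ψ ⟨i, j, c + 1⟩ = β (ψ ⟨i, j, c⟩)) :
    GraphIso (functionalGraph (Prod.map α β))
      (disjointUnion fun i => copies (k i) (cyc (m i) T)) := by
  have hr : ∀ w v, parentTo α z w = some v → depth hnil v < depth hnil w := by
    intro w v h
    obtain ⟨hw, rfl⟩ := parentTo_eq_some.1 h
    rw [depth_of_ne hnil hw]
    exact Nat.lt_succ_self _
  obtain ⟨τ, hinj, hroot, hedge, hnone, hrange⟩ := hT.exists_embedding hr T z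
  have hsurj : Surjective τ := by
    intro a
    refine (hrange a).1 ?_
    obtain ⟨n, hn⟩ : ∃ n, depth hnil a = n := ⟨_, rfl⟩
    induction n generalizing a with
    | zero =>
      have : a = z := by
        by_contra ha
        rw [depth_of_ne hnil ha] at hn
        omega
      exact this ▸ .refl
    | succ n ih =>
      have ha : a ≠ z := by
        rintro rfl
        rw [depth_root] at hn
        omega
      rw [depth_of_ne hnil ha] at hn
      exact .head (parentTo_eq_some.2 ⟨ha, rfl⟩) (ih _ (by omega))
  let τe : T.Vertex ≃ A := Equiv.ofBijective τ ⟨hinj, hsurj⟩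
  let e₁ : (Σ i, Σ _ : Fin (k i), ZMod (m i) × T.Vertex) ≃
      T.Vertex × (Σ i, Σ _ : Fin (k i), ZMod (m i)) :=
    { toFun := fun x => (x.2.2.2, ⟨x.1, x.2.1, x.2.2.1⟩)
      invFun := fun x => ⟨x.2.1, x.2.2.1, (x.2.2.2, x.1)⟩
      left_inv := fun _ => rfl
      right_inv := fun _ => rfl }
  -- along an edge of the tree the depth drops by one, which compensates the action of `β`
  let shear : A × B ≃ A × B := Equiv.prodShear (Equiv.refl A) fun a => (β ^ depth hnil a)⁻¹
  refine graphIso_of_hom (e₁.trans ((Equiv.prodCongr τe ψ).trans shear)) ?_ ?_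
  · rintro ⟨i, j, c, v⟩
    rcases hp : T.parent v with _ | w
    · exact ⟨⟨i, j, (c + 1, T.root)⟩, .mk i _ _ (.mk j _ _ (.inr ⟨hnone v hp, rfl, rfl⟩))⟩
    · exact ⟨⟨i, j, (c, w)⟩, .mk i _ _ (.mk j _ _ (.inl ⟨rfl, hp⟩))⟩
  · rintro _ _ ⟨i, _, _, ⟨j, ⟨c, v⟩, ⟨c', w⟩, h⟩⟩
    change (α (τ v), β ((β ^ depth hnil (τ v))⁻¹ (ψ ⟨i, j, c⟩))) =
      (τ w, (β ^ depth hnil (τ w))⁻¹ (ψ ⟨i, j, c'⟩))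
    rcases h with ⟨hc, hvw⟩ | ⟨hv, hw, hc⟩
    · obtain rfl : c = c' := hc
      obtain ⟨hne, hα⟩ := parentTo_eq_some.1 (hedge v w hvw)
      rw [depth_of_ne hnil hne, hα, pow_succ, mul_inv_rev]
      exact Prod.ext rfl (Equiv.apply_symm_apply β _)
    · obtain rfl : v = T.root := hv
      obtain rfl : w = T.root := hw
      obtain rfl : c' = c + 1 := hc
      rw [hroot, hz, depth_root, hψ]
      simp

end Product

/-! ### The tree of a nilpotent endomorphism -/

section Nilpotent

theorem HangsAt.join_of_forall₂ {M : Type*} {par : M → Option M} {v : M} {l : List M}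
    {L : List RTree} (hl : l.Nodup) (hmem : ∀ w, par w = some v ↔ w ∈ l)
    (h : List.Forall₂ (fun T w => HangsAt par T w) L l) : HangsAt par (RTree.join L) v := by
  obtain ⟨hlen, hget⟩ := List.forall₂_iff_get.1 h
  refine ⟨fun i => l.get (i.cast hlen), ?_, ?_, ?_⟩
  · exact (List.nodup_iff_injective_get.1 hl).comp (Fin.cast_injective hlen)
  · intro w
    rw [hmem, List.mem_iff_get]
    exact ⟨fun ⟨i, hi⟩ => ⟨i.cast hlen.symm, hi⟩, fun ⟨i, hi⟩ => ⟨i.cast hlen, hi⟩⟩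
  · intro i
    exact hget i i.2 (hlen ▸ i.2)

theorem forall₂_replicate_toList {M : Type*} {R : RTree → M → Prop} {T : RTree} {n : ℕ}
    {s : Finset M} (hn : s.card = n) (h : ∀ w ∈ s, R T w) :
    List.Forall₂ R (List.replicate n T) s.toList := by
  rw [List.forall₂_iff_get]
  refine ⟨by simp [hn], fun i h₁ h₂ => ?_⟩
  simp only [List.get_eq_getElem, List.getElem_replicate]
  exact h _ (Finset.mem_toList.1 (List.getElem_mem _))

/-- The predecessors of `v` are sorted by the last set of the decreasing sequence `H` that they
belong to; if the tree `T i` hangs at those whose last set is `H i`, the tree hanging at `v` follows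
from the numbers `c i` of predecessors in `H i`. -/
theorem HangsAt.join_of_layers {M : Type*} [Finite M] {par : M → Option M} {v : M}
    (H : ℕ → Set M) (hH : Antitone H) (h0 : H 0 = Set.univ) (k : ℕ) (T : ℕ → RTree) (c : ℕ → ℕ)
    (hC : ∀ w, par w = some v → w ∉ H (k + 1))
    (hc : ∀ i ≤ k, Set.ncard {w | par w = some v ∧ w ∈ H i} = c i)
    (hT : ∀ i ≤ k, ∀ w, par w = some v → w ∈ H i → w ∉ H (i + 1) → HangsAt par (T i) w) :
    HangsAt par (RTree.join (List.replicate (c k) (T k) ++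
      (List.finRange k).flatMap fun i : Fin k =>
        List.replicate (c i.val - c (i.val + 1)) (T i.val))) v := by
  classical
  have := Fintype.ofFinite M
  let D : ℕ → Finset M := fun i => {w | par w = some v ∧ w ∈ H i}
  have hD : ∀ i ≤ k, (D i).card = c i := fun i hi => by
    rw [← hc i hi, ← Set.ncard_coe_finset]
    simp [D]
  have hDmem : ∀ i w, w ∈ D i ↔ par w = some v ∧ w ∈ H i := by simp [D]
  let E : ℕ → Finset M := fun i => D i \ D (i + 1)
  have hEmem : ∀ i w, w ∈ E i ↔ par w = some v ∧ w ∈ H i ∧ w ∉ H (i + 1) := by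
    intro i w
    simp only [E, Finset.mem_sdiff, hDmem]
    tauto
  refine HangsAt.join_of_forall₂
    (l := (D k).toList ++ (List.finRange k).flatMap fun i : Fin k => (E i).toList) ?_ ?_ ?_
  · rw [List.nodup_append']
    refine ⟨Finset.nodup_toList _, List.nodup_flatMap.2 ⟨fun _ _ => Finset.nodup_toList _, ?_⟩, ?_⟩
    · refine (List.nodup_finRange k).imp ?_
      intro i j hij w hi hj
      rw [Finset.mem_toList, hEmem] at hi hj
      rcases lt_or_gt_of_ne (Fin.val_injective.ne hij) with h | h
      · exact hi.2.2 (hH h hj.2.1)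
      · exact hj.2.2 (hH h hi.2.1)
    · intro w hw hw'
      rw [Finset.mem_toList, hDmem] at hw
      obtain ⟨i, -, hi⟩ := List.mem_flatMap.1 hw'
      rw [Finset.mem_toList, hEmem] at hi
      exact hi.2.2 (hH i.2 hw.2)
  · intro w
    simp only [List.mem_append, List.mem_flatMap, Finset.mem_toList, hDmem, hEmem,
      List.mem_finRange, true_and]
    constructor
    · intro hw
      by_cases hk : w ∈ H k
      · exact .inl ⟨hw, hk⟩
      · right
        -- the largest `i` with `w ∈ H i`
        have hex : ∃ j, w ∉ H j := ⟨k, hk⟩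
        have hpos : Nat.find hex ≠ 0 := by
          intro h
          have := Nat.find_spec hex
          rw [h, h0] at this
          exact this trivial
        obtain ⟨i, hi⟩ := Nat.exists_eq_succ_of_ne_zero hpos
        have hik : i < k := by
          have := Nat.find_le (h := hex) hk
          omega
        exact ⟨⟨i, hik⟩, hw, not_not.1 (Nat.find_min hex (m := i) (by omega : i < Nat.find hex)),
          by simpa only [hi] using Nat.find_spec hex⟩
    · rintro (h | ⟨_, h, _⟩)
      exacts [h.1, h]
  · refine List.rel_append (forall₂_replicate_toList (hD k le_rfl) ?_) ?_
    · intro w hw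
      rw [hDmem] at hw
      exact hT k le_rfl w hw.1 hw.2 (hC w hw.1)
    · refine List.rel_flatMap (R := Eq) (by simp) ?_
      rintro i _ rfl
      refine forall₂_replicate_toList ?_ ?_
      · rw [Finset.card_sdiff_of_subset, hD _ i.2.le, hD _ i.2]
        intro w hw
        rw [hDmem] at hw ⊢
        exact ⟨hw.1, hH (Nat.le_succ _) hw.2⟩
      · intro w hw
        rw [hEmem] at hw
        exact hT i i.2.le w hw.1 hw.2.1 hw.2.2

variable {M : Type*} [AddCommGroup M] (φ : M →+ M)

theorem range_iterate_antitone {X : Type*} (φ : X → X) :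
    Antitone fun i => Set.range φ^[i] := by
  refine antitone_nat_of_succ_le fun i => ?_
  rintro _ ⟨x, rfl⟩
  exact ⟨φ x, rfl⟩

/-- The predecessors of `v` in the image of `φ^[i]` form a coset of `ker φ ∩ im φ^[i]`, provided
there is one. -/
theorem ncard_fiber_inter_range_iterate {v : M} (hv : v ≠ 0) {i : ℕ}
    (hvi : v ∈ Set.range φ^[i + 1]) :
    Set.ncard {w | parentTo φ 0 w = some v ∧ w ∈ Set.range φ^[i]} =
      Set.ncard {w | φ w = 0 ∧ w ∈ Set.range φ^[i]} := by
  obtain ⟨x, hx⟩ := hvi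
  rw [iterate_succ_apply'] at hx
  symm
  refine Set.ncard_congr (fun w _ => φ^[i] x + w) ?_ ?_ ?_
  · rintro _ ⟨hw, y, rfl⟩
    have h : φ (φ^[i] x + φ^[i] y) = v := by rw [map_add, hw, hx, add_zero]
    refine ⟨parentTo_eq_some.2 ⟨?_, h⟩, x + y, iterate_map_add φ i x y⟩
    intro h'
    rw [h', map_zero] at h
    exact hv h.symm
  · intro a b _ _ h
    exact add_left_cancel h
  · rintro _ ⟨hw, y, rfl⟩
    refine ⟨φ^[i] y - φ^[i] x, ⟨?_, y - x, iterate_map_sub φ i y x⟩, by abel⟩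
    rw [map_sub, (parentTo_eq_some.1 hw).2, hx, sub_self]

/-- At a nonzero element of height `k` hangs the tree `T_V^k`. -/
theorem hangsAt_partialTree [Finite M] {ν : ℕ → ℕ}
    (hν : ∀ i, Set.ncard {w | φ w = 0 ∧ w ∈ Set.range φ^[i]} = ν (i + 1)) (k : ℕ) :
    ∀ v, v ≠ 0 → v ∈ Set.range φ^[k] → v ∉ Set.range φ^[k + 1] →
      HangsAt (parentTo φ 0) (partialTree ν k) v := by
  induction k using Nat.strong_induction_on with
  | _ k ih =>
    intro v hv hk hk'
    rcases k with _ | k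
    · rw [partialTree]
      refine HangsAt.join_of_forall₂ (l := []) List.nodup_nil ?_ .nil
      intro w
      simp only [List.not_mem_nil, iff_false]
      exact fun hw => hk' ⟨w, (parentTo_eq_some.1 hw).2⟩
    · rw [partialTree]
      refine HangsAt.join_of_layers (fun i => Set.range φ^[i]) (range_iterate_antitone φ)
        (by simp) k (partialTree ν) (fun i => ν (i + 1)) ?_ ?_ ?_
      · rintro w hw ⟨x, rfl⟩
        refine hk' ⟨x, ?_⟩
        rw [iterate_succ_apply', (parentTo_eq_some.1 hw).2]
      · intro i hi
        rw [← hν, ncard_fiber_inter_range_iterate φ hv]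
        exact range_iterate_antitone φ (Nat.succ_le_succ hi) hk
      · intro i hi w hw h1 h2
        exact ih i (by omega) w (parentTo_eq_some.1 hw).1 h1 h2

/-- At `0` hangs `T_V`. It is not required that `d` be the nilpotency index: a larger `d` only
appends terms equal to `1` to `V`, which does not change `T_V`. -/
theorem hangsAt_elementaryTree [Finite M] {ν : ℕ → ℕ}
    (hν : ∀ i, Set.ncard {w | φ w = 0 ∧ w ∈ Set.range φ^[i]} = ν (i + 1)) {d : ℕ} (hd : 0 < d)
    (hnil : ∀ x, φ^[d] x = 0) :
    HangsAt (parentTo φ 0) (elementaryTree d ν) 0 := by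
  obtain ⟨k, rfl⟩ := Nat.exists_eq_succ_of_ne_zero hd.ne'
  -- `0` itself is not one of its predecessors in the tree
  have hc : ∀ i, Set.ncard {w | parentTo φ 0 w = some 0 ∧ w ∈ Set.range φ^[i]} =
      ν (i + 1) - 1 := by
    intro i
    rw [← hν, ← Set.ncard_sdiff_singleton_of_mem (a := (0 : M))]
    · congr 1
      ext w
      simp only [parentTo_eq_some, Set.mem_ofPred_eq, Set.mem_sdiff, Set.mem_singleton_iff]
      tauto
    · exact ⟨map_zero φ, 0, iterate_map_zero φ i⟩
  have hpos : ∀ i, 1 ≤ ν (i + 1) := by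
    intro i
    rw [← hν]
    exact (Set.ncard_pos (Set.toFinite _)).2 ⟨0, map_zero φ, 0, iterate_map_zero φ i⟩
  have hsub : ∀ i, ν (i + 1) - ν (i + 2) = (ν (i + 1) - 1) - (ν (i + 1 + 1) - 1) := by
    intro i
    have := hpos (i + 1)
    have := hpos i
    simp only [Nat.add_assoc, Nat.reduceAdd] at *
    omega
  unfold elementaryTree
  simp only [Nat.succ_eq_add_one, Nat.add_sub_cancel, hsub]
  refine HangsAt.join_of_layers (fun i => Set.range φ^[i]) (range_iterate_antitone φ)
    (by simp) k (partialTree ν) (fun i => ν (i + 1) - 1) ?_ (fun i _ => hc i) ?_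
  · rintro w hw ⟨x, rfl⟩
    exact (parentTo_eq_some.1 hw).1 (hnil x)
  · intro i _ w hw h1 h2
    exact hangsAt_partialTree φ hν i w (parentTo_eq_some.1 hw).1 h1 h2

end Nilpotent

/-! ### Multiplication maps between quotients by principal ideals -/

section MulMap

variable {R : Type*} [CommRing R] {b c g : R}

/-- Multiplication by `c` as a map from `R / (g)` to `R / (c g)`. The modulus of the target is a
variable `b` with `b = c * g`, so that different factorizations of `b` have the same target. -/
def mulMap (hb : b = c * g) : R ⧸ Ideal.span {g} →ₗ[R] R ⧸ Ideal.span {b} :=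
  Submodule.mapQ (Ideal.span {g}) (Ideal.span {b}) (LinearMap.mulLeft R c) <| by
    intro x hx
    rw [Ideal.mem_span_singleton] at hx
    rw [Submodule.mem_comap, LinearMap.mulLeft_apply, Ideal.mem_span_singleton, hb]
    exact mul_dvd_mul_left c hx

theorem mulMap_mk (hb : b = c * g) (x : R) :
    mulMap hb (Ideal.Quotient.mk _ x) = Ideal.Quotient.mk _ (c * x) := rfl

theorem mulMap_mul (hb : b = c * g) (x : R) (m : R ⧸ Ideal.span {g}) :
    mulMap hb (Ideal.Quotient.mk _ x * m) = Ideal.Quotient.mk _ x * mulMap hb m :=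
  (mulMap hb).map_smul x m

theorem mk_eq_zero_iff_dvd {x : R} : Ideal.Quotient.mk (Ideal.span {b}) x = 0 ↔ b ∣ x := by
  rw [Ideal.Quotient.eq_zero_iff_mem, Ideal.mem_span_singleton]

variable [IsDomain R]

theorem mulMap_injective (hb : b = c * g) (hc : c ≠ 0) : Injective (mulMap hb) := by
  rw [injective_iff_map_eq_zero]
  intro m hm
  obtain ⟨x, rfl⟩ := Ideal.Quotient.mk_surjective m
  rw [mulMap_mk, mk_eq_zero_iff_dvd, hb, mul_dvd_mul_iff_left hc] at hm
  exact mk_eq_zero_iff_dvd.2 hm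

theorem mem_range_mulMap (hb : b = c * g) (hg : g ≠ 0) (m : R ⧸ Ideal.span {b}) :
    m ∈ Set.range (mulMap hb) ↔ Ideal.Quotient.mk _ g * m = 0 := by
  constructor
  · rintro ⟨x, rfl⟩
    rw [← mulMap_mul, mk_eq_zero_iff_dvd.2 dvd_rfl, zero_mul, map_zero]
  · intro h
    obtain ⟨x, rfl⟩ := Ideal.Quotient.mk_surjective m
    rw [← map_mul, mk_eq_zero_iff_dvd, hb, mul_comm, mul_dvd_mul_iff_left hg] at h
    obtain ⟨y, rfl⟩ := h
    exact ⟨Ideal.Quotient.mk _ y, mulMap_mk hb y⟩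

theorem ncard_annihilated (hb : b = c * g) (hb0 : b ≠ 0) :
    Set.ncard {m : R ⧸ Ideal.span {b} | Ideal.Quotient.mk _ g * m = 0} =
      Nat.card (R ⧸ Ideal.span {g}) := by
  have hc : c ≠ 0 := left_ne_zero_of_mul (hb ▸ hb0)
  have hg : g ≠ 0 := right_ne_zero_of_mul (hb ▸ hb0)
  have : {m : R ⧸ Ideal.span {b} | Ideal.Quotient.mk _ g * m = 0} = Set.range (mulMap hb) := by
    ext m
    exact (mem_range_mulMap hb hg m).symm
  rw [this, ← Set.image_univ, Set.ncard_image_of_injective _ (mulMap_injective hb hc),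
    Set.ncard_univ]

end MulMap

/-! ### Cycles of multiplication by a unit -/

/-- Multiplication by `x` decomposes a finite commutative group into `#G / ord x` cycles of length
`ord x`, the cosets of the powers of `x`. -/
theorem exists_cycle_decomposition {G : Type*} [CommGroup G] [Finite G] (x : G) :
    ∃ χ : (Σ _ : Fin (Nat.card G / orderOf x), ZMod (orderOf x)) ≃ G,
      ∀ j c, χ ⟨j, c + 1⟩ = x * χ ⟨j, c⟩ := by
  have hpos := orderOf_pos x
  have : NeZero (orderOf x) := ⟨hpos.ne'⟩
  have hcard : Nat.card (G ⧸ Subgroup.zpowers x) = Nat.card G / orderOf x := by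
    rw [Subgroup.card_eq_card_quotient_mul_card_subgroup (Subgroup.zpowers x),
      Nat.card_zpowers, Nat.mul_div_cancel _ hpos]
  let e : Fin (Nat.card G / orderOf x) ≃ G ⧸ Subgroup.zpowers x :=
    (Finite.equivFinOfCardEq hcard).symm
  let χ : (Σ _ : Fin (Nat.card G / orderOf x), ZMod (orderOf x)) → G :=
    fun s => (e s.1).out * x ^ s.2.val
  have hinj : Injective χ := by
    rintro ⟨i, a⟩ ⟨j, b⟩ h
    have hmk : ∀ s, (QuotientGroup.mk (χ s) : G ⧸ Subgroup.zpowers x) = e s.1 := by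
      intro s
      rw [QuotientGroup.mk_mul_of_mem _ (Subgroup.npow_mem_zpowers x _), QuotientGroup.out_eq']
    obtain rfl : i = j := e.injective (by rw [← hmk ⟨i, a⟩, ← hmk ⟨j, b⟩, h])
    have h' : x ^ a.val = x ^ b.val := mul_left_cancel h
    rw [ZMod.val_injective _ (pow_injOn_Iio_orderOf (ZMod.val_lt a) (ZMod.val_lt b) h')]
  have hbij : Bijective χ := by
    refine (Nat.bijective_iff_injective_and_card χ).2 ⟨hinj, ?_⟩
    rw [Nat.card_sigma]
    simp only [Nat.card_zmod, Finset.sum_const, Finset.card_univ, Fintype.card_fin, smul_eq_mul]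
    exact Nat.div_mul_cancel (orderOf_dvd_natCard x)
  refine ⟨Equiv.ofBijective χ hbij, fun j c => ?_⟩
  change (e j).out * x ^ (c + 1).val = x * ((e j).out * x ^ c.val)
  rw [ZMod.val_add, pow_mod_orderOf, pow_add, ZMod.val_one_eq_one_mod, pow_mod_orderOf, pow_one,
    ← mul_assoc, mul_comm x]

variable {F : Type*} [Field F]

section Units

variable {b : F[X]}

theorem eq_div_mul_of_dvd {g : F[X]} (hg : g ≠ 0) (h : g ∣ b) : b = b / g * g := by
  rw [mul_comm, EuclideanDomain.mul_div_cancel' hg h]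

theorem div_ne_zero_of_dvd (hb : b ≠ 0) {g : F[X]} (hg : g ≠ 0) (h : g ∣ b) : b / g ≠ 0 :=
  left_ne_zero_of_mul (eq_div_mul_of_dvd hg h ▸ hb)

/-- The map sending a unit `w` of `F[X] / (g)`, for a monic divisor `g` of `b`, to the element
`(b / g) * w` of `F[X] / (b)`, which has annihilator `(g)`. -/
def unitsMap (b : F[X]) (s : Σ g : {g : F[X] // g.Monic ∧ g ∣ b},
    (F[X] ⧸ Ideal.span {g.1})ˣ) : F[X] ⧸ Ideal.span {b} :=
  mulMap (eq_div_mul_of_dvd s.1.2.1.ne_zero s.1.2.2) s.2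

theorem mk_mul_unitsMap (f : F[X]) (s : Σ g : {g : F[X] // g.Monic ∧ g ∣ b},
    (F[X] ⧸ Ideal.span {g.1})ˣ) :
    Ideal.Quotient.mk (Ideal.span {b}) f * unitsMap b s =
      mulMap (eq_div_mul_of_dvd s.1.2.1.ne_zero s.1.2.2)
        (Ideal.Quotient.mk (Ideal.span {s.1.1}) f * s.2) :=
  (mulMap_mul _ _ _).symm

theorem mk_mul_unitsMap_eq_zero_iff (hb : b ≠ 0) (f : F[X])
    (s : Σ g : {g : F[X] // g.Monic ∧ g ∣ b}, (F[X] ⧸ Ideal.span {g.1})ˣ) :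
    Ideal.Quotient.mk _ f * unitsMap b s = 0 ↔ s.1.1 ∣ f := by
  rw [mk_mul_unitsMap, map_eq_zero_iff _ (mulMap_injective _
    (div_ne_zero_of_dvd hb s.1.2.1.ne_zero s.1.2.2)), Units.mul_left_eq_zero, mk_eq_zero_iff_dvd]

theorem isUnit_mk_of_isCoprime {R : Type*} [CommRing R] {x g : R} (h : IsCoprime x g) :
    IsUnit (Ideal.Quotient.mk (Ideal.span {g}) x) := by
  obtain ⟨u, v, h⟩ := h
  refine IsUnit.of_mul_eq_one (Ideal.Quotient.mk _ u) ?_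
  rw [← map_mul, ← map_one (Ideal.Quotient.mk (Ideal.span {g})),
    Ideal.Quotient.mk_eq_mk_iff_sub_mem, Ideal.mem_span_singleton]
  exact ⟨-v, by linear_combination h⟩

/-- Every element of `F[X] / (b)` is `(b / g) * w` for a unique monic `g ∣ b`, the generator of its
annihilator, and a unique unit `w` modulo `g`. -/
theorem unitsMap_bijective (hb : b ≠ 0) : Bijective (unitsMap b) := by
  constructor
  · rintro s s' h
    have hs : s.1.1 ∣ s'.1.1 := by
      rw [← mk_mul_unitsMap_eq_zero_iff hb, h, mk_mul_unitsMap_eq_zero_iff hb]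
    have hs' : s'.1.1 ∣ s.1.1 := by
      rw [← mk_mul_unitsMap_eq_zero_iff hb, ← h, mk_mul_unitsMap_eq_zero_iff hb]
    obtain ⟨⟨g, hg⟩, w⟩ := s
    obtain ⟨⟨g', hg'⟩, w'⟩ := s'
    obtain rfl : g = g' := eq_of_dvd_of_natDegree_le_of_leadingCoeff hs
      (natDegree_le_of_dvd hs' hg.1.ne_zero) (hg.1.leadingCoeff.trans hg'.1.leadingCoeff.symm)
    have := mulMap_injective _ (div_ne_zero_of_dvd hb hg.1.ne_zero hg.2) h
    obtain rfl : w = w' := Units.ext this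
    rfl
  · intro m
    obtain ⟨x, rfl⟩ := Ideal.Quotient.mk_surjective m
    classical
    obtain ⟨x', g₀, hxg, hx, hbg⟩ : ∃ x' g₀, IsCoprime x' g₀ ∧
        x = EuclideanDomain.gcd x b * x' ∧ b = EuclideanDomain.gcd x b * g₀ := by
      obtain ⟨x', hx⟩ := EuclideanDomain.gcd_dvd_left x b
      obtain ⟨g₀, hg⟩ := EuclideanDomain.gcd_dvd_right x b
      refine ⟨x', g₀, ?_, hx, hg⟩
      have h0 : EuclideanDomain.gcd x b ≠ 0 := left_ne_zero_of_mul (hg ▸ hb)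
      refine ⟨EuclideanDomain.gcdA x b, EuclideanDomain.gcdB x b, mul_left_cancel₀ h0 ?_⟩
      have := EuclideanDomain.gcd_eq_gcd_ab x b
      linear_combination (-1 : F[X]) * this - EuclideanDomain.gcdA x b * hx
        - EuclideanDomain.gcdB x b * hg
    set d := EuclideanDomain.gcd x b
    have hg₀ : g₀ ≠ 0 := right_ne_zero_of_mul (hbg ▸ hb)
    -- the monic generator of the annihilator, and the unit relating it to `g₀`
    obtain ⟨w, hw⟩ := associated_normalize g₀
    have hmonic : (normalize g₀).Monic := monic_normalize hg₀
    have hb' : b = (d * ↑w⁻¹) * normalize g₀ := by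
      rw [← hw, mul_comm g₀, mul_assoc, Units.inv_mul_cancel_left]
      exact hbg
    have hcop : IsCoprime (↑w * x') (normalize g₀) := by
      rw [← hw]
      exact (isCoprime_mul_unit_left_left w.isUnit _ _).2
        ((isCoprime_mul_unit_right_right w.isUnit _ _).2 hxg)
    refine ⟨⟨⟨normalize g₀, hmonic, ⟨_, hb'.trans (mul_comm _ _)⟩⟩,
      (isUnit_mk_of_isCoprime hcop).unit⟩, ?_⟩
    change Ideal.Quotient.mk _ (b / normalize g₀ * (↑w * x')) = _
    have hdiv : b / normalize g₀ = d * ↑w⁻¹ := by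
      conv_lhs => rw [hb']
      exact mul_div_cancel_right₀ _ hmonic.ne_zero
    rw [hdiv, mul_assoc, Units.inv_mul_cancel_left, ← hx]

theorem exists_equiv_units_cycles [Finite F] (hb : b ≠ 0) {f : F[X]} (hf : IsCoprime f b) :
    ∃ ψ : (Σ g : {g : F[X] // g.Monic ∧ g ∣ b},
        Σ _ : Fin (polyPhi g.1 / polyOrd f g.1), ZMod (polyOrd f g.1)) ≃ F[X] ⧸ Ideal.span {b},
      ∀ i j c, ψ ⟨i, j, c + 1⟩ = Ideal.Quotient.mk _ f * ψ ⟨i, j, c⟩ := by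
  have key : ∀ g : {g : F[X] // g.Monic ∧ g ∣ b},
      ∃ χ : (Σ _ : Fin (polyPhi g.1 / polyOrd f g.1), ZMod (polyOrd f g.1)) ≃
        (F[X] ⧸ Ideal.span {g.1})ˣ, ∀ j c, (χ ⟨j, c + 1⟩ : F[X] ⧸ Ideal.span {g.1}) =
          Ideal.Quotient.mk (Ideal.span {g.1}) f * χ ⟨j, c⟩ := by
    intro g
    have := g.2.1.finite_quotient
    have : Finite (F[X] ⧸ Ideal.span {g.1}) := Module.finite_of_finite F
    obtain ⟨x, hx⟩ := isUnit_mk_of_isCoprime (hf.of_isCoprime_of_dvd_right g.2.2)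
    have hord : polyOrd f g.1 = orderOf x := by rw [polyOrd, ← hx, orderOf_units]
    rw [hord, ← hx, polyPhi]
    obtain ⟨χ, hχ⟩ := exists_cycle_decomposition x
    exact ⟨χ, fun j c => by rw [hχ, Units.val_mul]⟩
  choose χ hχ using key
  refine ⟨(Equiv.sigmaCongrRight χ).trans (Equiv.ofBijective _ (unitsMap_bijective hb)), ?_⟩
  intro i j c
  change unitsMap b ⟨i, χ i ⟨j, c + 1⟩⟩ = Ideal.Quotient.mk _ f * unitsMap b ⟨i, χ i ⟨j, c⟩⟩
  rw [mk_mul_unitsMap, ← hχ]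
  rfl

end Units

/-! ### The `ν`-series and the tree of a nilpotent multiplication -/

section NuSeries

theorem monicGcd_dvd_left (a b : F[X]) : monicGcd a b ∣ a := by
  classical
  exact normalize_dvd_iff.2 (EuclideanDomain.gcd_dvd_left a b)

theorem monicGcd_dvd_right (a b : F[X]) : monicGcd a b ∣ b := by
  classical
  exact normalize_dvd_iff.2 (EuclideanDomain.gcd_dvd_right a b)

theorem dvd_monicGcd {a b c : F[X]} (ha : c ∣ a) (hb : c ∣ b) : c ∣ monicGcd a b := by
  classical
  exact dvd_normalize_iff.2 (EuclideanDomain.dvd_gcd ha hb)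

theorem monic_monicGcd {a b : F[X]} (h : a ≠ 0 ∨ b ≠ 0) : (monicGcd a b).Monic := by
  classical
  refine monic_normalize fun h0 => ?_
  rw [EuclideanDomain.gcd_eq_zero_iff] at h0
  tauto

theorem exists_eq_monicGcd_mul {a b : F[X]} (h : a ≠ 0 ∨ b ≠ 0) :
    ∃ a' b', IsCoprime a' b' ∧ a = monicGcd a b * a' ∧ b = monicGcd a b * b' := by
  obtain ⟨a', ha⟩ := monicGcd_dvd_left a b
  obtain ⟨b', hb⟩ := monicGcd_dvd_right a b
  refine ⟨a', b', ?_, ha, hb⟩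
  have h0 := (monic_monicGcd h).ne_zero
  classical
  rw [← EuclideanDomain.gcd_isUnit_iff]
  refine isUnit_of_dvd_one ((mul_dvd_mul_iff_left h0).1 ?_)
  rw [mul_one]
  refine dvd_monicGcd ?_ ?_
  · conv_rhs => rw [ha]
    exact mul_dvd_mul_left _ (EuclideanDomain.gcd_dvd_left _ _)
  · conv_rhs => rw [hb]
    exact mul_dvd_mul_left _ (EuclideanDomain.gcd_dvd_right _ _)

variable {b f : F[X]}

/-- With `P = a_1 ⋯ a_i` and `r = b / P`, the cofactor of `P` in `f ^ i` is prime to `r`. In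
particular `P` is a greatest common divisor of `b` and `f ^ i`. -/
theorem nuSeries_invariant (hb : b ≠ 0) (i : ℕ) :
    b = (∏ j ∈ Finset.Icc 1 i, nuFactor b f j) * nuRest b f i ∧
      ∃ y, f ^ i = (∏ j ∈ Finset.Icc 1 i, nuFactor b f j) * y ∧ IsCoprime y (nuRest b f i) := by
  induction i with
  | zero => exact ⟨by simp [nuRest], 1, by simp, isCoprime_one_left⟩
  | succ i ih =>
    obtain ⟨hbi, y, hy, hcop⟩ := ih
    have hr : nuRest b f i ≠ 0 := right_ne_zero_of_mul (hbi ▸ hb)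
    obtain ⟨r', f', hrf, hr', hf'⟩ := exists_eq_monicGcd_mul (b := f) (Or.inl hr)
    have hrest : nuRest b f (i + 1) = r' := by
      exact (EuclideanDomain.eq_div_of_mul_eq_right
        (monic_monicGcd (Or.inl hr)).ne_zero hr'.symm).symm
    have hfac : nuFactor b f (i + 1) = monicGcd (nuRest b f i) f := rfl
    rw [Finset.prod_Icc_succ_top (by omega), hrest, hfac]
    refine ⟨by rw [mul_assoc, ← hr', ← hbi], y * f', ?_, ?_⟩
    · rw [pow_succ, hy]
      linear_combination (∏ j ∈ Finset.Icc 1 i, nuFactor b f j) * y * hf'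
    · have hdvd : r' ∣ nuRest b f i := Dvd.intro_left _ hr'.symm
      exact (hcop.of_isCoprime_of_dvd_right hdvd).mul_left hrf.symm

theorem iterate_mulLeft_apply {R : Type*} [CommRing R] (x m : R) (i : ℕ) :
    (AddMonoidHom.mulLeft x)^[i] m = x ^ i * m := by
  induction i with
  | zero => simp
  | succ i ih => rw [iterate_succ_apply', ih, AddMonoidHom.coe_mulLeft, pow_succ', mul_assoc]

theorem mk_mem_range_iterate_iff (hb : b ≠ 0) (i : ℕ) (x : F[X]) :
    Ideal.Quotient.mk (Ideal.span {b}) x ∈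
        Set.range (AddMonoidHom.mulLeft (Ideal.Quotient.mk (Ideal.span {b}) f))^[i] ↔
      ∏ j ∈ Finset.Icc 1 i, nuFactor b f j ∣ x := by
  obtain ⟨hbi, y, hy, u, v, huv⟩ := nuSeries_invariant (f := f) hb i
  set P := ∏ j ∈ Finset.Icc 1 i, nuFactor b f j
  constructor
  · rintro ⟨m, hm⟩
    obtain ⟨z, rfl⟩ := Ideal.Quotient.mk_surjective m
    rw [iterate_mulLeft_apply, ← map_pow, ← map_mul, Ideal.Quotient.mk_eq_mk_iff_sub_mem,
      Ideal.mem_span_singleton] at hm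
    rw [hy, mul_assoc] at hm
    exact (dvd_sub_right (dvd_mul_right P _)).1 ((Dvd.intro _ hbi.symm).trans hm)
  · rintro ⟨z, rfl⟩
    refine ⟨Ideal.Quotient.mk _ (u * z), ?_⟩
    rw [iterate_mulLeft_apply, ← map_pow, ← map_mul, Ideal.Quotient.mk_eq_mk_iff_sub_mem,
      Ideal.mem_span_singleton]
    refine ⟨-(v * z), ?_⟩
    rw [hy]
    linear_combination P * z * huv + v * z * hbi

/-- The kernel of `f` on `f ^ i F[X] / (b)` consists of the elements annihilated by `a_(i + 1)`, so
it has `N(a_(i + 1))` elements. -/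
theorem ncard_ker_inter_range_iterate (hb : b ≠ 0) (i : ℕ) :
    Set.ncard {w | AddMonoidHom.mulLeft (Ideal.Quotient.mk (Ideal.span {b}) f) w = 0 ∧
      w ∈ Set.range (AddMonoidHom.mulLeft (Ideal.Quotient.mk (Ideal.span {b}) f))^[i]} =
      polyNorm (nuFactor b f (i + 1)) := by
  obtain ⟨hbi, -⟩ := nuSeries_invariant (f := f) hb i
  have hP : ∏ j ∈ Finset.Icc 1 i, nuFactor b f j ≠ 0 := left_ne_zero_of_mul (hbi ▸ hb)
  have hr : nuRest b f i ≠ 0 := right_ne_zero_of_mul (hbi ▸ hb)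
  obtain ⟨r', f', hrf, hr', hf'⟩ := exists_eq_monicGcd_mul (b := f) (Or.inl hr)
  have ha : monicGcd (nuRest b f i) f ≠ 0 := (monic_monicGcd (Or.inl hr)).ne_zero
  have hfac : nuFactor b f (i + 1) = monicGcd (nuRest b f i) f := rfl
  have hset := ncard_annihilated (b := b) (c := (∏ j ∈ Finset.Icc 1 i, nuFactor b f j) * r')
    (g := nuFactor b f (i + 1)) (by rw [hfac, mul_assoc, mul_comm r', ← hr', ← hbi]) hb
  rw [polyNorm, ← hset]
  congr 1
  ext m
  obtain ⟨x, rfl⟩ := Ideal.Quotient.mk_surjective m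
  rw [Set.mem_ofPred_eq, Set.mem_ofPred_eq, mk_mem_range_iterate_iff hb, AddMonoidHom.coe_mulLeft,
    ← map_mul, ← map_mul, mk_eq_zero_iff_dvd, mk_eq_zero_iff_dvd, hfac]
  generalize monicGcd (nuRest b f i) f = a at *
  generalize ∏ j ∈ Finset.Icc 1 i, nuFactor b f j = P at *
  rw [hbi, hr', hf']
  have hassoc : P * (a * r') = a * (P * r') := mul_left_comm _ _ _
  rw [hassoc, mul_dvd_mul_iff_left ha, mul_assoc, mul_dvd_mul_iff_left ha]
  constructor
  · rintro ⟨h, z, rfl⟩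
    rw [mul_left_comm, mul_dvd_mul_iff_left hP] at h
    exact mul_dvd_mul_left _ (hrf.dvd_of_dvd_mul_left h)
  · intro h
    exact ⟨h.mul_left _, (Dvd.intro _ rfl).trans h⟩

theorem nuLength_spec (hb : b ≠ 0) {N : ℕ} (hN : b ∣ f ^ N) :
    0 < nuLength b f ∧
      Ideal.span {∏ j ∈ Finset.Icc 1 (nuLength b f), nuFactor b f j} = Ideal.span {b} := by
  refine Nat.sInf_mem (s := {d : ℕ | 0 < d ∧
    Ideal.span {∏ j ∈ Finset.Icc 1 d, nuFactor b f j} = Ideal.span {b}})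
    -- `N` itself may be `0`, but the length is positive
    ⟨N + 1, Nat.succ_pos N, ?_⟩
  obtain ⟨hbi, y, hy, hcop⟩ := nuSeries_invariant (f := f) hb (N + 1)
  have hP : ∏ j ∈ Finset.Icc 1 (N + 1), nuFactor b f j ≠ 0 := left_ne_zero_of_mul (hbi ▸ hb)
  have hdvd : nuRest b f (N + 1) ∣ y := by
    rw [← mul_dvd_mul_iff_left hP, ← hbi, ← hy]
    exact hN.trans (pow_dvd_pow f (Nat.le_succ N))
  rw [Ideal.span_singleton_eq_span_singleton]
  conv_rhs => rw [hbi]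
  exact associated_mul_unit_right _ _ (hcop.isUnit_of_dvd' hdvd dvd_rfl)

theorem pow_nuLength_eq_zero (hb : b ≠ 0) {N : ℕ} (hN : b ∣ f ^ N) :
    Ideal.Quotient.mk (Ideal.span {b}) f ^ nuLength b f = 0 := by
  obtain ⟨-, y, hy, -⟩ := nuSeries_invariant (f := f) hb (nuLength b f)
  rw [← map_pow, mk_eq_zero_iff_dvd, hy]
  exact ((Ideal.span_singleton_eq_span_singleton.1 (nuLength_spec hb hN).2).symm.dvd).mul_right _

theorem hangsAt_nuTree [Finite F] (hb : b.Monic) {N : ℕ} (hN : b ∣ f ^ N) :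
    HangsAt (parentTo (AddMonoidHom.mulLeft (Ideal.Quotient.mk (Ideal.span {b}) f)) 0)
      (nuTree b f) 0 := by
  have := hb.finite_quotient
  have : Finite (F[X] ⧸ Ideal.span {b}) := Module.finite_of_finite F
  refine hangsAt_elementaryTree _ (fun i => ncard_ker_inter_range_iterate hb.ne_zero i)
    (nuLength_spec hb.ne_zero hN).1 fun x => ?_
  rw [iterate_mulLeft_apply, pow_nuLength_eq_zero hb.ne_zero hN, zero_mul]

end NuSeries

/-! ### Splitting by the Chinese remainder theorem -/

theorem graphIso_mul_quotient [Finite F] {b s f : F[X]} (hb : b.Monic) (hs : s ≠ 0) {N : ℕ}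
    (hN : b ∣ f ^ N) (hf : IsCoprime f s) :
    GraphIso
      (functionalGraph fun m : F[X] ⧸ Ideal.span {b * s} => Ideal.Quotient.mk _ f * m)
      (disjointUnion fun g : {g : F[X] // g.Monic ∧ g ∣ s} =>
        copies (polyPhi g.1 / polyOrd f g.1) (cyc (polyOrd f g.1) (nuTree b f))) := by
  have hbs : IsCoprime b s := (hf.pow_left (m := N)).of_isCoprime_of_dvd_left hN
  obtain ⟨ψ, hψ⟩ := exists_equiv_units_cycles hs hf
  have hunit := isUnit_mk_of_isCoprime hf
  let e : F[X] ⧸ Ideal.span {b * s} ≃+* (F[X] ⧸ Ideal.span {b}) × (F[X] ⧸ Ideal.span {s}) :=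
    (Ideal.quotEquivOfEq (Ideal.span_singleton_mul_span_singleton b s).symm).trans
      (Ideal.quotientMulEquivQuotientProd _ _
        ((Ideal.isCoprime_span_singleton_iff b s).2 hbs))
  have he : ∀ x, e (Ideal.Quotient.mk _ x) = (Ideal.Quotient.mk _ x, Ideal.Quotient.mk _ x) :=
    fun _ => rfl
  refine graphIso_functionalGraph_of_semiconj
    (ψ := Prod.map (AddMonoidHom.mulLeft (Ideal.Quotient.mk (Ideal.span {b}) f))
      hunit.unit.mulLeft) e.toEquiv ?_ ?_
  · intro m
    change e (_ * m) = _
    rw [map_mul, he]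
    rfl
  · refine graphIso_prodMap (map_zero _) (fun a => ⟨nuLength b f, ?_⟩)
      (hangsAt_nuTree hb hN) _ _ _ ψ hψ
    rw [iterate_mulLeft_apply, pow_nuLength_eq_zero hb.ne_zero hN, zero_mul]

/-! ### The field as a module over the polynomial ring via Frobenius -/

section Frobenius

variable {K : Type*} [Field K] [Algebra F K]

theorem aeval_qAssociate [Fintype F] (f : F[X]) (c : K) :
    aeval c (qAssociate f) =
      aeval (FiniteField.frobeniusAlgHom F K).toLinearMap f c := by
  rw [qAssociate, sum_def, map_sum, aeval_def (FiniteField.frobeniusAlgHom F K).toLinearMap,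
    eval₂_eq_sum, sum_def, LinearMap.sum_apply]
  refine Finset.sum_congr rfl fun i _ => ?_
  rw [aeval_monomial, Module.End.mul_apply, Module.algebraMap_end_apply, Algebra.smul_def,
    Module.End.pow_apply, AlgHom.coe_toLinearMap, FiniteField.coe_frobeniusAlgHom, pow_iterate,
    Nat.card_eq_fintype_card]

/-- The normal basis theorem: `K` is a cyclic `F[X]`-module with `X` acting as Frobenius, with
annihilator generated by the minimal polynomial `X ^ n - 1` of Frobenius. -/
theorem exists_equiv_quotient [Fintype F] [Finite K] :
    ∃ e : (F[X] ⧸ Ideal.span {(X ^ Module.finrank F K - 1 : F[X])}) ≃ K,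
      ∀ f m, e (Ideal.Quotient.mk _ f * m) =
        aeval (FiniteField.frobeniusAlgHom F K).toLinearMap f (e m) := by
  set σ := (FiniteField.frobeniusAlgHom F K).toLinearMap
  have hpos : 0 < Module.finrank F K := Module.finrank_pos
  have hmonic : (X ^ Module.finrank F K - 1 : F[X]).Monic := leadingCoeff_X_pow_sub_one hpos
  obtain ⟨x, hx⟩ := Module.exists_ker_toSpanSingleton_eq_annihilator F[X] (Module.AEval' σ)
  rw [← span_minpoly_eq_annihilator, FiniteField.minpoly_frobeniusAlgHom] at hx
  let ι := Submodule.liftQ _ (LinearMap.toSpanSingleton F[X] (Module.AEval' σ) x) hx.ge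
  have hinj : Injective ι := LinearMap.ker_eq_bot.1 (Submodule.ker_liftQ_eq_bot' _ _ hx.symm)
  let κ : (F[X] ⧸ Ideal.span {(X ^ Module.finrank F K - 1 : F[X])}) →ₗ[F] K :=
    (Module.AEval'.of σ).symm.toLinearMap ∘ₗ ι.restrictScalars F
  have hκ : Injective κ := (Module.AEval'.of σ).symm.injective.comp hinj
  have := hmonic.finite_quotient
  have hrank : Module.finrank F (F[X] ⧸ Ideal.span {(X ^ Module.finrank F K - 1 : F[X])}) =
      Module.finrank F K := by
    rw [finrank_quotient_span_eq_natDegree]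
    exact natDegree_X_pow_sub_C (r := (1 : F))
  have hsurj : Surjective κ := (LinearMap.injective_iff_surjective_of_finrank_eq_finrank hrank).1 hκ
  refine ⟨Equiv.ofBijective κ ⟨hκ, hsurj⟩, fun f m => ?_⟩
  change (Module.AEval'.of σ).symm (ι (f • m)) = aeval σ f ((Module.AEval'.of σ).symm (ι m))
  rw [map_smul]
  exact Module.AEval.of_symm_smul σ f (ι m)

end Frobenius

/-! ### The coprime part -/

/-- A common divisor of `f` and `S_f` divides both `h = gcd (f, X ^ u - 1)` and `S_f`, which are
coprime because their product `X ^ u - 1` is separable. -/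
theorem isCoprime_coprimePart {f : F[X]} (hf : f ≠ 0) {u : ℕ} (hu : (u : F) ≠ 0) :
    IsCoprime f (coprimePart f u) := by
  set h := monicGcd f (X ^ u - 1)
  have h0 : h ≠ 0 := (monic_monicGcd (Or.inl hf)).ne_zero
  have hfac : h * coprimePart f u = X ^ u - 1 :=
    EuclideanDomain.mul_div_cancel' h0 (monicGcd_dvd_right _ _)
  have hsep : (h * coprimePart f u).Separable := hfac ▸ X_pow_sub_one_separable_iff.2 hu
  have hcop : IsCoprime h (coprimePart f u) := hsep.isCoprime
  classical
  rw [← EuclideanDomain.gcd_isUnit_iff]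
  refine hcop.isUnit_of_dvd' (dvd_monicGcd (EuclideanDomain.gcd_dvd_left _ _) ?_)
    (EuclideanDomain.gcd_dvd_right _ _)
  rw [← hfac]
  exact (EuclideanDomain.gcd_dvd_right _ _).mul_left _

end LinDyn

end

theorem mainTheorem2 {F : Type*} [Field F] [Finite F] {K : Type*} [Field K] [Algebra F K]
    (p : ℕ) [CharP F p] (n t u : ℕ) (hn : n = p ^ t * u) (hu : ¬ p ∣ u)
    (hK : Module.finrank F K = n) (f : F[X]) (hf : f ≠ 0) :
    (∀ g : F[X], g.Monic → g ∣ LinDyn.coprimePart f u ^ p ^ t →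
      IsCoprime f g ∧ 0 < LinDyn.polyOrd f g ∧ LinDyn.polyOrd f g ∣ LinDyn.polyPhi g) ∧
    LinDyn.GraphIso
      (LinDyn.functionalGraph fun c : K => aeval c (LinDyn.qAssociate f))
      (LinDyn.disjointUnion
        fun g : {g : F[X] // g.Monic ∧ g ∣ LinDyn.coprimePart f u ^ p ^ t} =>
          LinDyn.copies (LinDyn.polyPhi g.1 / LinDyn.polyOrd f g.1)
            (LinDyn.cyc (LinDyn.polyOrd f g.1)
              (LinDyn.nuTree (LinDyn.monicGcd f (X ^ u - 1) ^ p ^ t) f))) := by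
  open LinDyn in
  have := Fintype.ofFinite F
  have hp : p.Prime := CharP.char_is_prime F p
  have : Fact p.Prime := ⟨hp⟩
  have hu0 : (u : F) ≠ 0 := fun h => hu ((CharP.cast_eq_zero_iff F p u).1 h)
  have hcop : IsCoprime f (coprimePart f u ^ p ^ t) := (isCoprime_coprimePart hf hu0).pow_right
  have hmonic : (monicGcd f (X ^ u - 1)).Monic := monic_monicGcd (Or.inl hf)
  have hfac : monicGcd f (X ^ u - 1) * coprimePart f u = X ^ u - 1 :=
    EuclideanDomain.mul_div_cancel' hmonic.ne_zero (monicGcd_dvd_right _ _)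
  have hupos : 0 < u := Nat.pos_of_ne_zero fun h => hu (h ▸ dvd_zero p)
  have hn0 : 0 < n := hn ▸ Nat.mul_pos (pow_pos hp.pos t) hupos
  have hS0 : coprimePart f u ≠ 0 :=
    right_ne_zero_of_mul (hfac ▸ (monic_X_pow_sub_C (1 : F) hupos.ne').ne_zero)
  have hXn : (X ^ Module.finrank F K - 1 : F[X]) =
      monicGcd f (X ^ u - 1) ^ p ^ t * coprimePart f u ^ p ^ t := by
    rw [← mul_pow, hfac, sub_pow_char_pow, one_pow, ← pow_mul, hK, hn, mul_comm]
  have : FiniteDimensional F K := Module.finite_of_finrank_pos (hK ▸ hn0)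
  have : Finite K := Module.finite_of_finite F
  refine ⟨fun g hg hgS => ?_, ?_⟩
  · have hfg := hcop.of_isCoprime_of_dvd_right hgS
    have := hg.finite_quotient
    have : Finite (F[X] ⧸ Ideal.span {g}) := Module.finite_of_finite F
    obtain ⟨x, hx⟩ := isUnit_mk_of_isCoprime hfg
    rw [polyOrd, ← hx, orderOf_units]
    exact ⟨hfg, orderOf_pos x, orderOf_dvd_natCard x⟩
  · have key := exists_equiv_quotient (F := F) (K := K)
    rw [hXn] at key
    obtain ⟨e, he⟩ := key
    refine graphIso_functionalGraph_of_semiconj e.symm ?_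
      (graphIso_mul_quotient (hmonic.pow _) (pow_ne_zero _ hS0)
        (pow_dvd_pow_of_dvd (monicGcd_dvd_left _ _) _) hcop)
    intro c
    rw [Equiv.symm_apply_eq, he, e.apply_symm_apply]
    exact aeval_qAssociate f c
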